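/- Let $k$ be an algebraically closed field of characteristic zero and let $L$ be a finite-dimensional Lie algebra over $k$. For $\xi\in L^*$ put $L(\xi)=\{x\in L \mid \xi([x,y])=0 \text{ for all } y\in L\}$. The index of $L$ is $i(L)=\min_{\xi\in L^*}\dim L(\xi)$, and $\xi$ is called regular if $\dim L(\xi)=i(L)$. Put $c(L)=(\dim L+i(L))/2$. The Frobenius semiradical of $L$ is $F(L)=\sum_{\xi \text{ regular}}L(\xi)$, and $L$ is called quasi quadratic if $F(L)=L$. The Lie algebra $L$ is said to have the $R$-property (Rentschler's property) if it has an abelian subalgebra of dimension $c(L)$ or an abelian subalgebra of dimension $c(L)-1$. **Theorem 5.2.** Let $L$ be solvable of dimension $n$. 1. If $n\leq 6$, then $L$ has the $R$-property. 2. If $n=7$, then $L$ has the $R$-property if one of the following conditions is satisfied: (i) $i(L)\neq 3$; (ii) $i(L)=3$ and $L$ is not quasi quadratic. -/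

import Mathlib

namespace RentschlerProperty

section

variable (k : Type*) {L : Type*} [Field k] [LieRing L] [LieAlgebra k L]

/-- The stabilizer `L(ξ) = {x ∈ L ∣ ξ [x, y] = 0 for all y ∈ L}` of a linear functional `ξ ∈ L*`. -/
def stabilizer (ξ : Module.Dual k L) : Submodule k L where
  carrier := {x | ∀ y : L, ξ ⁅x, y⁆ = 0}
  add_mem' := by
    intro a b ha hb y
    rw [add_lie, map_add, ha y, hb y, add_zero]
  zero_mem' := by
    intro y
    rw [zero_lie, map_zero]
  smul_mem' := by
    intro c a ha y
    rw [smul_lie, map_smul, ha y, smul_zero]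

variable (L)

/-- The index `i(L)`: the minimal dimension of a stabilizer `L(ξ)`, `ξ ∈ L*`. -/
noncomputable def index : ℕ :=
  sInf (Set.range fun ξ : Module.Dual k L => Module.finrank k (stabilizer k ξ))

/-- The magic number `c(L) = (dim L + i(L)) / 2`, as a rational number (so no rounding occurs). -/
noncomputable def magicNumber : ℚ :=
  ((Module.finrank k L : ℚ) + (index k L : ℚ)) / 2

variable {L}

/-- `ξ ∈ L*` is regular if `dim L(ξ) = i(L)`. -/
def IsRegularFunctional (ξ : Module.Dual k L) : Prop :=
  Module.finrank k (stabilizer k ξ) = index k L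

/-- A commutative polarization (CP) of `L`: a commutative subalgebra of dimension `c(L)`. -/
def IsCommutativePolarization (P : LieSubalgebra k L) : Prop :=
  IsLieAbelian P ∧ (Module.finrank k P : ℚ) = magicNumber k L

variable (L)

/-- The Frobenius semiradical `F(L)`: the sum of the stabilizers `L(ξ)` over all regular `ξ`. -/
def frobeniusSemiradical : Submodule k L :=
  ⨆ (ξ : Module.Dual k L) (_ : IsRegularFunctional k ξ), stabilizer k ξ

/-- `L` is quasi quadratic if `F(L) = L`. -/
def IsQuasiQuadratic : Prop :=
  frobeniusSemiradical k L = ⊤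

/-- Rentschler's property: `L` admits a CP or an abelian subalgebra of dimension `c(L) - 1`. -/
def HasRProperty : Prop :=
  (∃ P : LieSubalgebra k L, IsCommutativePolarization k P) ∨
    ∃ H : LieSubalgebra k L, IsLieAbelian H ∧ (Module.finrank k H : ℚ) = magicNumber k L - 1

end

end RentschlerProperty

/-! Write n = dim L = i(L) + 2m, so that c(L) = i(L) + m. If m = 0, every stabilizer is L and L is
abelian. If m = 1, a regular stabilizer has dimension i(L) = c(L) - 1 and is abelian, because
otherwise a small perturbation of the functional would have rank four
(`lie_eq_zero_of_mem_stabilizer`).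

For m ≥ 2 solvability enters. An abelian ideal A of maximal dimension d equals its own centralizer,
and Lie's theorem embeds L/A in the upper triangular d × d matrices, so n ≤ d + d(d+1)/2. This makes
A large enough in every case except n = 7, i(L) = 3, d = 3, where an abelian subalgebra of dimension
c(L) - 1 = 4 is needed.

In that case L/A is a 4-dimensional algebra of upper triangular 3 × 3 matrices. If E₁₃ and E₂₃
belong to it, together with a matrix t satisfying t₁₁ + t₂₂ ≠ 3t₃₃, lifts of E₁₃ and E₂₃ can be
corrected by multiples of e₃ so as to commute; with e₁ and e₂ they span the required subalgebra
(`AbelianFlag.exists_commuting_of_actsBy`). Closure under brackets and i(L) = 3 leave only one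
obstruction: e₁ is central, E₁₂ and E₁₃ act, and some t has t₂₂t₃₃ ≠ 0. Such an L is quasi quadratic
(`AbelianFlag.isQuasiQuadratic_of_actsBy`), which the hypothesis excludes. -/

namespace RentschlerProperty

/-! ### Stabilizers, Pfaffians and self-centralizing ideals -/

section Generalities

open Module

variable {k L : Type*} [Field k] [LieRing L] [LieAlgebra k L]

/-- The alternating form `(x, y) ↦ ξ ⁅x, y⁆` attached to a functional `ξ`. -/
def bracketForm (ξ : Dual k L) : LinearMap.BilinForm k L :=
  (LieModule.toEnd k L L : L →ₗ[k] End k L).compr₂ ξ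

@[simp]
lemma bracketForm_apply (ξ : Dual k L) (x y : L) : bracketForm ξ x y = ξ ⁅x, y⁆ := rfl

/-- A nondegenerate alternating form lives on an even-dimensional space. -/
lemma even_finrank_of_isAlt {V : Type*} [AddCommGroup V] [Module k V] [FiniteDimensional k V]
    [CharZero k] (B : LinearMap.BilinForm k V) (hB : B.IsAlt) (hB' : B.Nondegenerate) :
    Even (finrank k V) := by
  by_contra hodd
  rw [Nat.not_even_iff_odd] at hodd
  let b := finBasis k V
  have hdet := (LinearMap.BilinForm.nondegenerate_iff_det_ne_zero b).mp hB'
  have ht : (LinearMap.BilinForm.toMatrix b B).transpose = -LinearMap.BilinForm.toMatrix b B := by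
    ext i j
    simp only [Matrix.transpose_apply, Matrix.neg_apply, LinearMap.BilinForm.toMatrix_apply]
    rw [LinearMap.IsAlt.neg hB]
  have h := congrArg Matrix.det ht
  rw [Matrix.det_transpose, Matrix.det_neg, Fintype.card_fin, hodd.neg_one_pow] at h
  have : (2 : k) * (LinearMap.BilinForm.toMatrix b B).det = 0 := by linear_combination h
  exact hdet ((mul_eq_zero.mp this).resolve_left two_ne_zero)

/-- The stabilizer is the radical of `bracketForm ξ`, so the form is nondegenerate on any
complement, which therefore has even dimension. -/
lemma even_finrank_sub_finrank_stabilizer [FiniteDimensional k L] [CharZero k] (ξ : Dual k L) :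
    ∃ m, finrank k L = finrank k (stabilizer k ξ) + 2 * m := by
  obtain ⟨W, hW⟩ := Submodule.exists_isCompl (stabilizer k ξ)
  have hs : ∀ x y, ξ ⁅x, y⁆ = -ξ ⁅y, x⁆ := fun x y ↦ by rw [← lie_skew, map_neg]
  have halt : ((bracketForm ξ).restrict W).IsAlt := fun x ↦
    show ξ ⁅(x : L), (x : L)⁆ = 0 by rw [lie_self, map_zero]
  have key : ∀ x : W, (∀ y : W, ξ ⁅(x : L), (y : L)⁆ = 0) → x = 0 := by
    intro x hx
    have : (x : L) ∈ stabilizer k ξ := by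
      intro y
      obtain ⟨s, hs', w, hw, rfl⟩ := Submodule.mem_sup.mp
        (show y ∈ stabilizer k ξ ⊔ W by rw [hW.sup_eq_top]; trivial)
      rw [lie_add, map_add, hx ⟨w, hw⟩, hs, hs' x]
      simp
    have := Submodule.disjoint_def.mp hW.disjoint _ this x.2
    exact Subtype.ext this
  have hnd : ((bracketForm ξ).restrict W).Nondegenerate :=
    ⟨fun x hx ↦ key x hx, fun x hx ↦ key x fun y ↦ by rw [hs]; simpa using hx y⟩
  obtain ⟨m, hm⟩ := even_finrank_of_isAlt _ halt hnd
  exact ⟨m, by rw [← Submodule.finrank_add_eq_of_isCompl hW, hm]; ring⟩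

lemma index_le (ξ : Dual k L) : index k L ≤ finrank k (stabilizer k ξ) :=
  Nat.sInf_le ⟨ξ, rfl⟩

variable (k L) in
lemma exists_isRegularFunctional : ∃ ξ : Dual k L, IsRegularFunctional k ξ :=
  Nat.sInf_mem (Set.range_nonempty fun ξ : Dual k L ↦ finrank k (stabilizer k ξ))

/-- An abelian subspace of large enough dimension gives the `R`-property. -/
lemma hasRProperty_of_commuting [FiniteDimensional k L] (H : Submodule k L)
    (hH : ∀ x ∈ H, ∀ y ∈ H, ⁅x, y⁆ = 0) {d : ℕ} (hd : d ≤ finrank k H)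
    (hc : (d : ℚ) = magicNumber k L ∨ (d : ℚ) = magicNumber k L - 1) : HasRProperty k L := by
  let b := finBasis k H
  let v : Fin d → L := fun i ↦ (b (Fin.castLE hd i) : L)
  have hv : LinearIndependent k v :=
    (b.linearIndependent.map' H.subtype H.ker_subtype).comp _ (Fin.castLE_injective hd)
  have hle : Submodule.span k (Set.range v) ≤ H := by
    rw [Submodule.span_le]
    rintro _ ⟨i, rfl⟩
    exact (b (Fin.castLE hd i)).2
  let P : LieSubalgebra k L :=
    { Submodule.span k (Set.range v) with
      lie_mem' := fun {x y} hx hy ↦ by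
        rw [hH x (hle hx) y (hle hy)]
        exact (Submodule.span k (Set.range v)).zero_mem }
  have hP : IsLieAbelian P :=
    ⟨fun x y ↦ Subtype.ext (hH x (hle x.2) y (hle y.2))⟩
  have hf : finrank k P = d := (finrank_span_eq_card hv).trans (Fintype.card_fin d)
  rcases hc with hc | hc
  · exact Or.inl ⟨P, hP, by rw [hf, hc]⟩
  · exact Or.inr ⟨P, hP, by rw [hf, hc]⟩

lemma exists_dual_apply_eq {V ι : Type*} [AddCommGroup V] [Module k V] {v : ι → V}
    (hv : LinearIndependent k v) (c : ι → k) : ∃ f : Dual k V, ∀ i, f (v i) = c i := by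
  obtain ⟨f, hf⟩ := ((Basis.span hv).constr k c).exists_extend
  refine ⟨f, fun i ↦ ?_⟩
  have := LinearMap.congr_fun hf (Basis.span hv i)
  rw [Basis.constr_basis] at this
  rw [← this]
  simp [Basis.span_apply]

/-- A nonzero Pfaffian of size four bounds the dimension of the stabilizer. -/
lemma finrank_stabilizer_add_four_le [FiniteDimensional k L] {ξ : Dual k L} {x y s t : L}
    (hP : ξ ⁅x, y⁆ * ξ ⁅s, t⁆ - ξ ⁅x, s⁆ * ξ ⁅y, t⁆ + ξ ⁅x, t⁆ * ξ ⁅y, s⁆ ≠ 0) :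
    finrank k (stabilizer k ξ) + 4 ≤ finrank k L := by
  let v : Fin 4 → L := ![x, y, s, t]
  let Φ : L →ₗ[k] (Fin 4 → k) := LinearMap.pi fun i ↦ (bracketForm ξ).flip (v i)
  let g : (Fin 4 → k) →ₗ[k] L := Fintype.linearCombination k v
  have hle : stabilizer k ξ ≤ LinearMap.ker Φ := by
    intro w hw
    ext i
    exact hw (v i)
  have hinj : Function.Injective (Φ ∘ₗ g) := by
    rw [← LinearMap.ker_eq_bot, LinearMap.ker_eq_bot']
    intro m hm
    have e := fun i ↦ congrFun hm i
    have hs : ∀ a b : L, ξ ⁅a, b⁆ = -ξ ⁅b, a⁆ := fun a b ↦ by rw [← lie_skew, map_neg]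
    have e0 := e 0
    have e1 := e 1
    have e2 := e 2
    have e3 := e 3
    simp [Φ, g, v, Fintype.linearCombination_apply, Fin.sum_univ_four] at e0 e1 e2 e3
    rw [hs y x, hs s x, hs t x] at e0
    rw [hs s y, hs t y] at e1
    rw [hs t s] at e2
    funext i
    -- A skew 4 × 4 matrix times its Pfaffian adjoint is the Pfaffian times the identity; the
    -- adjoint supplies the coefficients below.
    apply (mul_eq_zero.mp ?_).resolve_right hP
    fin_cases i
    · change m 0 * _ = 0
      linear_combination ξ ⁅s, t⁆ * e1 - ξ ⁅y, t⁆ * e2 + ξ ⁅y, s⁆ * e3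
    · change m 1 * _ = 0
      linear_combination -ξ ⁅s, t⁆ * e0 + ξ ⁅x, t⁆ * e2 - ξ ⁅x, s⁆ * e3
    · change m 2 * _ = 0
      linear_combination ξ ⁅y, t⁆ * e0 - ξ ⁅x, t⁆ * e1 + ξ ⁅x, y⁆ * e3
    · change m 3 * _ = 0
      linear_combination -ξ ⁅y, s⁆ * e0 + ξ ⁅x, s⁆ * e1 - ξ ⁅x, y⁆ * e2
  have hsurj : Function.Surjective Φ :=
    Function.Surjective.of_comp (LinearMap.injective_iff_surjective.mp hinj)
  have h1 := Φ.finrank_range_add_finrank_ker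
  rw [LinearMap.range_eq_top.mpr hsurj, finrank_top, finrank_fin_fun] at h1
  have := Submodule.finrank_mono hle
  omega

/-- If all stabilizers have codimension at most two, those of codimension two are abelian. -/
lemma lie_eq_zero_of_mem_stabilizer [FiniteDimensional k L] [CharZero k] {ξ : Dual k L}
    (hn : finrank k L ≤ index k L + 2) {x y : L} (hxy : ξ ⁅x, y⁆ = 1) {s t : L}
    (hs : s ∈ stabilizer k ξ) (ht : t ∈ stabilizer k ξ) : ⁅s, t⁆ = 0 := by
  by_contra hst
  obtain ⟨η, hη⟩ := exists_dual_apply_eq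
    (LinearIndependent.of_subsingleton (v := fun _ : Unit ↦ ⁅s, t⁆) () hst) (fun _ ↦ (1 : k))
  replace hη := hη ()
  have e1 : ξ ⁅x, s⁆ = 0 := by rw [← lie_skew, map_neg, hs x, neg_zero]
  have e2 : ξ ⁅x, t⁆ = 0 := by rw [← lie_skew, map_neg, ht x, neg_zero]
  have e3 : ξ ⁅y, s⁆ = 0 := by rw [← lie_skew, map_neg, hs y, neg_zero]
  have e4 : ξ ⁅y, t⁆ = 0 := by rw [← lie_skew, map_neg, ht y, neg_zero]
  -- As s and t lie in the radical of ξ, the Pfaffian of ξ + τη on x, y, s, t has no constant term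
  -- and linear coefficient ξ[x,y]·η[s,t] = 1. It must vanish for every τ, since rank four is
  -- excluded.
  have key : ∀ τ : k, τ * (1 + τ * (η ⁅x, y⁆ - η ⁅x, s⁆ * η ⁅y, t⁆ + η ⁅x, t⁆ * η ⁅y, s⁆)) = 0 := by
    intro τ
    by_contra hτ
    have := finrank_stabilizer_add_four_le (ξ := ξ + τ • η) (x := x) (y := y) (s := s) (t := t) <| by
      simp only [LinearMap.add_apply, LinearMap.smul_apply, smul_eq_mul, e1, e2, e3, e4, hη, hxy,
        hs t]
      convert hτ using 1
      ring
    have := index_le (ξ + τ • η)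
    omega
  have h1 := key 1
  have h2 := key 2
  have : (2 : k) = 0 := by linear_combination -h2 + 4 * h1
  exact two_ne_zero this

/-- A vector of `I` which is an eigenvector of `L` modulo the smaller ideal `N`. -/
lemma exists_eigenvector_mod [IsAlgClosed k] [CharZero k] [FiniteDimensional k L]
    [LieAlgebra.IsSolvable L] {N I : LieIdeal k L} (h : N < I) :
    ∃ x ∈ I, x ∉ N ∧ ∃ χ : Dual k L, ∀ y, ⁅y, x⁆ - χ y • x ∈ N := by
  let M : LieSubmodule k L (L ⧸ N) :=
    LieSubmodule.map (LieSubmodule.Quotient.mk' N) I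
  obtain ⟨z, hzI, hzN⟩ := SetLike.exists_of_lt h
  have hM : Nontrivial M := by
    refine nontrivial_of_ne ⟨LieSubmodule.Quotient.mk' N z, LieSubmodule.mem_map_of_mem hzI⟩ 0 ?_
    intro h0
    exact hzN ((LieSubmodule.Quotient.mk_eq_zero N).mp (congrArg Subtype.val h0))
  obtain ⟨χ, hχ⟩ := LieModule.exists_nontrivial_weightSpace_of_isSolvable k L M
  obtain ⟨⟨⟨v, hvM⟩, hv⟩, hv0⟩ := exists_ne (0 : LieModule.weightSpace M χ)
  obtain ⟨x, hx, rfl⟩ := (LieSubmodule.mem_map _).mp hvM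
  refine ⟨x, hx, fun hxN ↦ hv0 ?_, χ, fun y ↦ ?_⟩
  · apply Subtype.ext
    apply Subtype.ext
    exact (LieSubmodule.Quotient.mk_eq_zero N).mpr hxN
  · rw [LieModule.mem_weightSpace] at hv
    have := congrArg Subtype.val (hv y)
    rw [← LieSubmodule.Quotient.mk_eq_zero, map_sub, map_smul, LieModuleHom.map_lie, sub_eq_zero]
    exact this

/-- The ideal spanned by an ideal `N` and an eigenvector modulo `N`. -/
def adjoinEigenvector (N : LieIdeal k L) (x : L) (χ : Dual k L)
    (h : ∀ y, ⁅y, x⁆ - χ y • x ∈ N) : LieIdeal k L :=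
  { N.toSubmodule ⊔ k ∙ x with
    lie_mem := by
      intro y m hm
      obtain ⟨n, hn, z, hz, rfl⟩ := Submodule.mem_sup.mp hm
      obtain ⟨c, rfl⟩ := Submodule.mem_span_singleton.mp hz
      refine Submodule.mem_sup.mpr ⟨⁅y, n⁆ + c • (⁅y, x⁆ - χ y • x),
        N.add_mem (N.lie_mem hn) (N.smul_mem c (h y)), (c * χ y) • x,
        Submodule.smul_mem _ _ (Submodule.mem_span_singleton_self x), ?_⟩
      rw [lie_add, lie_smul, smul_sub, smul_smul]
      abel }

lemma mem_adjoinEigenvector {N : LieIdeal k L} {x : L} {χ : Dual k L}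
    {h : ∀ y, ⁅y, x⁆ - χ y • x ∈ N} {z : L} :
    z ∈ adjoinEigenvector N x χ h ↔ ∃ n ∈ N, ∃ c : k, n + c • x = z := by
  change z ∈ N.toSubmodule ⊔ k ∙ x ↔ _
  simp [Submodule.mem_sup, Submodule.mem_span_singleton]

lemma finrank_adjoinEigenvector [FiniteDimensional k L] {N : LieIdeal k L} {x : L} {χ : Dual k L}
    {h : ∀ y, ⁅y, x⁆ - χ y • x ∈ N} (hx : x ∉ N) :
    finrank k (adjoinEigenvector N x χ h) = finrank k N + 1 := by
  have := Submodule.finrank_sup_add_finrank_inf_eq N.toSubmodule (k ∙ x)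
  have hx0 : x ≠ 0 := fun h0 ↦ hx (h0 ▸ N.zero_mem)
  have hinf : N.toSubmodule ⊓ k ∙ x = ⊥ := by
    rw [← disjoint_iff, Submodule.disjoint_span_singleton' hx0]
    exact hx
  rw [hinf, finrank_bot, finrank_span_singleton hx0] at this
  exact this

/-- A solvable Lie algebra has a self-centralizing abelian ideal. -/
lemma exists_selfCentralizing_ideal (k L : Type*) [Field k] [LieRing L] [LieAlgebra k L]
    [IsAlgClosed k] [CharZero k] [FiniteDimensional k L] [LieAlgebra.IsSolvable L] :
    ∃ A : LieIdeal k L, (∀ x ∈ A, ∀ y ∈ A, ⁅x, y⁆ = 0) ∧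
      ∀ x, (∀ y ∈ A, ⁅x, y⁆ = 0) → x ∈ A := by
  let S : Set ℕ := {d | ∃ A : LieIdeal k L, (∀ x ∈ A, ∀ y ∈ A, ⁅x, y⁆ = 0) ∧ finrank k A = d}
  have hS : S.Nonempty := ⟨_, ⊥, fun x hx y _ ↦ by
    rw [(LieSubmodule.mem_bot x).mp hx, zero_lie], rfl⟩
  have hb : BddAbove S := ⟨finrank k L, by
    rintro _ ⟨A, -, rfl⟩
    exact Submodule.finrank_le A.toSubmodule⟩
  obtain ⟨A, hA, hAd⟩ := Nat.sSup_mem hS hb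
  refine ⟨A, hA, ?_⟩
  -- The centralizer of A is an ideal. Were it larger than A, adjoining to A an eigenvector of the
  -- centralizer modulo A would give a larger abelian ideal.
  let C : LieIdeal k L :=
    { carrier := {x | ∀ y ∈ A, ⁅x, y⁆ = 0}
      add_mem' := fun {a b} ha hb y hy ↦ by rw [add_lie, ha y hy, hb y hy, add_zero]
      zero_mem' := fun y _ ↦ zero_lie y
      smul_mem' := fun c a ha y hy ↦ by rw [smul_lie, ha y hy, smul_zero]
      lie_mem := fun {z a} ha y hy ↦ by
        rw [lie_lie, ha y hy, lie_zero, ha _ (A.lie_mem hy), sub_zero] }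
  have hAC : A ≤ C := fun x hx ↦ hA x hx
  by_contra hne
  have hlt : A < C := lt_of_le_of_ne hAC fun h ↦ hne fun x hx ↦ by
    rw [h]; exact hx
  obtain ⟨x, hxC, hxA, χ, hχ⟩ := exists_eigenvector_mod hlt
  have hmem : finrank k (adjoinEigenvector A x χ hχ) ∈ S := by
    refine ⟨_, ?_, rfl⟩
    intro y hy z hz
    obtain ⟨a, ha, c, rfl⟩ := mem_adjoinEigenvector.mp hy
    obtain ⟨b, hb, d, rfl⟩ := mem_adjoinEigenvector.mp hz
    have h1 : ⁅a, x⁆ = 0 := by rw [← lie_skew, hxC a ha, neg_zero]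
    simp [hA a ha b hb, hxC b hb, h1]
  have := le_csSup hb hmem
  rw [finrank_adjoinEigenvector hxA, hAd] at this
  omega

end Generalities

/-! ### Three-dimensional self-centralizing ideals and matrix entries -/

section Flag

open Module

variable {k L : Type*} [Field k] [LieRing L] [LieAlgebra k L]

lemma lie_eq_zero_of_mem_span {s : Set L} (hs : ∀ x ∈ s, ∀ y ∈ s, ⁅x, y⁆ = 0) :
    ∀ x ∈ Submodule.span k s, ∀ y ∈ Submodule.span k s, ⁅x, y⁆ = 0 := by
  intro x hx y hy
  induction hx, hy using Submodule.span_induction₂ with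
  | mem_mem x y hx hy => exact hs x hx y hy
  | zero_left y hy => exact zero_lie y
  | zero_right x hx => exact lie_zero x
  | add_left x y z _ _ _ h1 h2 => rw [add_lie, h1, h2, add_zero]
  | add_right x y z _ _ _ h1 h2 => rw [lie_add, h1, h2, add_zero]
  | smul_left r x y _ _ h => rw [smul_lie, h, smul_zero]
  | smul_right r x y _ _ h => rw [lie_smul, h, smul_zero]

variable (k L) in
/-- A three-dimensional self-centralizing abelian ideal with an invariant flag, together with the
matrix entries `qᵢⱼ` of the (upper triangular) adjoint action on it. -/
structure AbelianFlag where
  (e₁ e₂ e₃ : L)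
  (q₁₁ q₁₂ q₁₃ q₂₂ q₂₃ q₃₃ : Dual k L)
  linearIndependent : LinearIndependent k ![e₁, e₂, e₃]
  lie₁₂ : ⁅e₁, e₂⁆ = 0
  lie₁₃ : ⁅e₁, e₃⁆ = 0
  lie₂₃ : ⁅e₂, e₃⁆ = 0
  lie_e₁ : ∀ x, ⁅x, e₁⁆ = q₁₁ x • e₁
  lie_e₂ : ∀ x, ⁅x, e₂⁆ = q₁₂ x • e₁ + q₂₂ x • e₂
  lie_e₃ : ∀ x, ⁅x, e₃⁆ = q₁₃ x • e₁ + q₂₃ x • e₂ + q₃₃ x • e₃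
  selfCentralizing : ∀ x, q₁₁ x = 0 → q₁₂ x = 0 → q₁₃ x = 0 → q₂₂ x = 0 → q₂₃ x = 0 →
    q₃₃ x = 0 → ∃ a b c : k, x = a • e₁ + b • e₂ + c • e₃

namespace AbelianFlag

variable (A : AbelianFlag k L)

lemma eq_zero_of_sum_eq_zero {a b c : k} (h : a • A.e₁ + b • A.e₂ + c • A.e₃ = 0) :
    a = 0 ∧ b = 0 ∧ c = 0 := by
  have := Fintype.linearIndependent_iff.mp A.linearIndependent ![a, b, c]
    (by simpa [Fin.sum_univ_three] using h)
  exact ⟨this 0, this 1, this 2⟩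

/-- This lemma and the next two are the entries of the commutator of two upper triangular matrices,
as x ↦ (qᵢⱼ x) is a representation. -/
lemma q₁₁_lie (x y : L) : A.q₁₁ ⁅x, y⁆ = 0 := by
  have h := lie_lie x y A.e₁
  simp only [A.lie_e₁, lie_smul] at h
  have : (A.q₁₁ ⁅x, y⁆) • A.e₁ + (0 : k) • A.e₂ + (0 : k) • A.e₃ = 0 := by
    rw [h]; module
  exact (A.eq_zero_of_sum_eq_zero this).1

lemma q_lie_e₂ (x y : L) :
    A.q₁₂ ⁅x, y⁆ = A.q₁₁ x * A.q₁₂ y + A.q₁₂ x * A.q₂₂ y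
      - (A.q₁₁ y * A.q₁₂ x + A.q₁₂ y * A.q₂₂ x) ∧ A.q₂₂ ⁅x, y⁆ = 0 := by
  have h := lie_lie x y A.e₂
  simp only [A.lie_e₁, A.lie_e₂, lie_add, lie_smul] at h
  have : (A.q₁₂ ⁅x, y⁆ - (A.q₁₁ x * A.q₁₂ y + A.q₁₂ x * A.q₂₂ y
      - (A.q₁₁ y * A.q₁₂ x + A.q₁₂ y * A.q₂₂ x))) • A.e₁ + (A.q₂₂ ⁅x, y⁆) • A.e₂
      + (0 : k) • A.e₃ = 0 := by
    linear_combination (norm := module) h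
  have := A.eq_zero_of_sum_eq_zero this
  exact ⟨sub_eq_zero.mp this.1, this.2.1⟩

lemma q_lie_e₃ (x y : L) :
    A.q₁₃ ⁅x, y⁆ = A.q₁₁ x * A.q₁₃ y + A.q₁₂ x * A.q₂₃ y + A.q₁₃ x * A.q₃₃ y
      - (A.q₁₁ y * A.q₁₃ x + A.q₁₂ y * A.q₂₃ x + A.q₁₃ y * A.q₃₃ x) ∧
    A.q₂₃ ⁅x, y⁆ = A.q₂₂ x * A.q₂₃ y + A.q₂₃ x * A.q₃₃ y
      - (A.q₂₂ y * A.q₂₃ x + A.q₂₃ y * A.q₃₃ x) ∧ A.q₃₃ ⁅x, y⁆ = 0 := by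
  have h := lie_lie x y A.e₃
  simp only [A.lie_e₁, A.lie_e₂, A.lie_e₃, lie_add, lie_smul] at h
  have : (A.q₁₃ ⁅x, y⁆ - (A.q₁₁ x * A.q₁₃ y + A.q₁₂ x * A.q₂₃ y + A.q₁₃ x * A.q₃₃ y
      - (A.q₁₁ y * A.q₁₃ x + A.q₁₂ y * A.q₂₃ x + A.q₁₃ y * A.q₃₃ x))) • A.e₁
      + (A.q₂₃ ⁅x, y⁆ - (A.q₂₂ x * A.q₂₃ y + A.q₂₃ x * A.q₃₃ y
      - (A.q₂₂ y * A.q₂₃ x + A.q₂₃ y * A.q₃₃ x))) • A.e₂ + (A.q₃₃ ⁅x, y⁆) • A.e₃ = 0 := by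
    linear_combination (norm := module) h
  have := A.eq_zero_of_sum_eq_zero this
  exact ⟨sub_eq_zero.mp this.1, sub_eq_zero.mp this.2.1, this.2.2⟩

lemma lie_e₂₁ : ⁅A.e₂, A.e₁⁆ = 0 := by rw [← lie_skew, A.lie₁₂, neg_zero]

lemma lie_e₃₁ : ⁅A.e₃, A.e₁⁆ = 0 := by rw [← lie_skew, A.lie₁₃, neg_zero]

lemma lie_e₃₂ : ⁅A.e₃, A.e₂⁆ = 0 := by rw [← lie_skew, A.lie₂₃, neg_zero]

lemma q_eq_zero {x : L} (h₁ : ⁅x, A.e₁⁆ = 0) (h₂ : ⁅x, A.e₂⁆ = 0) (h₃ : ⁅x, A.e₃⁆ = 0) :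
    A.q₁₁ x = 0 ∧ A.q₁₂ x = 0 ∧ A.q₁₃ x = 0 ∧ A.q₂₂ x = 0 ∧ A.q₂₃ x = 0 ∧ A.q₃₃ x = 0 := by
  rw [A.lie_e₁] at h₁
  rw [A.lie_e₂] at h₂
  rw [A.lie_e₃] at h₃
  have h1 := A.eq_zero_of_sum_eq_zero (a := A.q₁₁ x) (b := 0) (c := 0) (by simpa using h₁)
  have h2 := A.eq_zero_of_sum_eq_zero (a := A.q₁₂ x) (b := A.q₂₂ x) (c := 0) (by simpa using h₂)
  have h3 := A.eq_zero_of_sum_eq_zero h₃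
  exact ⟨h1.1, h2.1, h3.1, h2.2.1, h3.2.1, h3.2.2⟩

lemma q_e₁ : A.q₁₁ A.e₁ = 0 ∧ A.q₁₂ A.e₁ = 0 ∧ A.q₁₃ A.e₁ = 0 ∧ A.q₂₂ A.e₁ = 0 ∧
    A.q₂₃ A.e₁ = 0 ∧ A.q₃₃ A.e₁ = 0 :=
  A.q_eq_zero (lie_self _) A.lie₁₂ A.lie₁₃

lemma q_e₂ : A.q₁₁ A.e₂ = 0 ∧ A.q₁₂ A.e₂ = 0 ∧ A.q₁₃ A.e₂ = 0 ∧ A.q₂₂ A.e₂ = 0 ∧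
    A.q₂₃ A.e₂ = 0 ∧ A.q₃₃ A.e₂ = 0 :=
  A.q_eq_zero A.lie_e₂₁ (lie_self _) A.lie₂₃

lemma q_e₃ : A.q₁₁ A.e₃ = 0 ∧ A.q₁₂ A.e₃ = 0 ∧ A.q₁₃ A.e₃ = 0 ∧ A.q₂₂ A.e₃ = 0 ∧
    A.q₂₃ A.e₃ = 0 ∧ A.q₃₃ A.e₃ = 0 :=
  A.q_eq_zero A.lie_e₃₁ A.lie_e₃₂ (lie_self _)

/-- `x` acts on the ideal by the upper triangular matrix with the given entries. -/
def ActsBy (x : L) (a₁₁ a₁₂ a₁₃ a₂₂ a₂₃ a₃₃ : k) : Prop :=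
  A.q₁₁ x = a₁₁ ∧ A.q₁₂ x = a₁₂ ∧ A.q₁₃ x = a₁₃ ∧ A.q₂₂ x = a₂₂ ∧ A.q₂₃ x = a₂₃ ∧ A.q₃₃ x = a₃₃

lemma exists_eq_of_actsBy_zero {x : L} (h : A.ActsBy x 0 0 0 0 0 0) :
    ∃ a b c : k, x = a • A.e₁ + b • A.e₂ + c • A.e₃ :=
  A.selfCentralizing x h.1 h.2.1 h.2.2.1 h.2.2.2.1 h.2.2.2.2.1 h.2.2.2.2.2

/-- Two elements acting as `E₁₃` and `E₂₃` can be corrected to span, together with `e₁` and `e₂`,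
an abelian subalgebra, provided some weight does not vanish. -/
lemma exists_commuting_of_actsBy [FiniteDimensional k L] {x y : L}
    (hx : A.ActsBy x 0 0 1 0 0 0) (hy : A.ActsBy y 0 0 0 0 1 0) (t : L)
    (ht : A.q₁₁ t + A.q₂₂ t ≠ 3 * A.q₃₃ t) :
    ∃ H : Submodule k L, (∀ x ∈ H, ∀ y ∈ H, ⁅x, y⁆ = 0) ∧ 4 ≤ finrank k H := by
  obtain ⟨x11, x12, x13, x22, x23, x33⟩ := hx
  obtain ⟨y11, y12, y13, y22, y23, y33⟩ := hy
  have hxe₁ : ⁅x, A.e₁⁆ = 0 := by simp [A.lie_e₁, *]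
  have hxe₂ : ⁅x, A.e₂⁆ = 0 := by simp [A.lie_e₂, *]
  have hxe₃ : ⁅x, A.e₃⁆ = A.e₁ := by simp [A.lie_e₃, *]
  have hye₁ : ⁅y, A.e₁⁆ = 0 := by simp [A.lie_e₁, *]
  have hye₂ : ⁅y, A.e₂⁆ = 0 := by simp [A.lie_e₂, *]
  have hye₃ : ⁅y, A.e₃⁆ = A.e₂ := by simp [A.lie_e₃, *]
  obtain ⟨b₁, b₂, b₃, hb⟩ := A.exists_eq_of_actsBy_zero (x := ⁅x, y⁆) <| by
    simp [ActsBy, A.q₁₁_lie, A.q_lie_e₂, A.q_lie_e₃, *]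
  obtain ⟨a₁, a₂, a₃, ha⟩ := A.exists_eq_of_actsBy_zero
      (x := ⁅t, x⁆ - (A.q₁₁ t - A.q₃₃ t) • x) <| by
    simp [ActsBy, A.q₁₁_lie, A.q_lie_e₂, A.q_lie_e₃, *]
  obtain ⟨c₁, c₂, c₃, hc⟩ := A.exists_eq_of_actsBy_zero
      (x := ⁅t, y⁆ - (A.q₁₂ t • x + (A.q₂₂ t - A.q₃₃ t) • y)) <| by
    simp [ActsBy, A.q₁₁_lie, A.q_lie_e₂, A.q_lie_e₃, *]
  rw [sub_eq_iff_eq_add] at ha hc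
  -- Modulo A, ad t acts on the span of x and y with trace t₁₁ + t₂₂ - 2t₃₃. The e₃-coefficient of
  -- the Jacobi identity for t, x, y thus reads t₃₃b₃ = (t₁₁ + t₂₂ - 2t₃₃)b₃.
  have hb₃ : b₃ = 0 := by
    have h := leibniz_lie t x y
    have hy₁ : ⁅A.e₁, y⁆ = 0 := by rw [← lie_skew, hye₁, neg_zero]
    have hy₂ : ⁅A.e₂, y⁆ = 0 := by rw [← lie_skew, hye₂, neg_zero]
    have hy₃ : ⁅A.e₃, y⁆ = -A.e₂ := by rw [← lie_skew, hye₃]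
    rw [ha, hc, hb] at h
    simp only [lie_add, lie_smul, add_lie, smul_lie, A.lie_e₁ t, A.lie_e₂ t, A.lie_e₃ t, hxe₁, hxe₂,
      hxe₃, hy₁, hy₂, hy₃, hb, lie_self] at h
    have h' := (A.eq_zero_of_sum_eq_zero (a := b₁ * A.q₁₁ t + b₂ * A.q₁₂ t + b₃ * A.q₁₃ t
        - (A.q₁₁ t + A.q₂₂ t - 2 * A.q₃₃ t) * b₁ - c₃)
      (b := b₂ * A.q₂₂ t + b₃ * A.q₂₃ t - (A.q₁₁ t + A.q₂₂ t - 2 * A.q₃₃ t) * b₂ + a₃)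
      (c := (3 * A.q₃₃ t - (A.q₁₁ t + A.q₂₂ t)) * b₃) (by
        linear_combination (norm := module) h)).2.2
    exact (mul_eq_zero.mp h').resolve_left (sub_ne_zero.mpr ht.symm)
  subst hb₃
  -- Now [x, y] = b₁e₁ + b₂e₂. Since [x, e₃] = e₁ and [y, e₃] = e₂, these multiples of e₃ cancel it.
  let v : Fin 4 → L := ![A.e₁, A.e₂, x + b₂ • A.e₃, y - b₁ • A.e₃]
  have hv : LinearIndependent k v := by
    rw [Fintype.linearIndependent_iff]
    intro g hg
    simp only [v, Fin.sum_univ_four, Matrix.cons_val] at hg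
    have h2 : g 2 = 0 := by
      have := congrArg A.q₁₃ hg
      simpa [A.q_e₁, A.q_e₂, A.q_e₃, *] using this
    have h3 : g 3 = 0 := by
      have := congrArg A.q₂₃ hg
      simpa [A.q_e₁, A.q_e₂, A.q_e₃, *] using this
    have := A.eq_zero_of_sum_eq_zero (a := g 0) (b := g 1) (c := 0) (by simpa [h2, h3] using hg)
    intro i
    fin_cases i
    exacts [this.1, this.2.1, h2, h3]
  refine ⟨Submodule.span k (Set.range v), lie_eq_zero_of_mem_span ?_,
    ((finrank_span_eq_card hv).trans (Fintype.card_fin 4)).ge⟩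
  have hskew : ∀ i j, ⁅v i, v j⁆ = 0 → ⁅v j, v i⁆ = 0 := fun i j h ↦ by
    rw [← lie_skew, h, neg_zero]
  have h01 : ⁅v 0, v 1⁆ = 0 := A.lie₁₂
  have h20 : ⁅v 2, v 0⁆ = 0 := by simp [v, hxe₁, A.lie_e₃₁]
  have h21 : ⁅v 2, v 1⁆ = 0 := by simp [v, hxe₂, A.lie_e₃₂]
  have h30 : ⁅v 3, v 0⁆ = 0 := by simp [v, hye₁, A.lie_e₃₁]
  have h31 : ⁅v 3, v 1⁆ = 0 := by simp [v, hye₂, A.lie_e₃₂]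
  have h23 : ⁅v 2, v 3⁆ = 0 := by
    have hy₃ : ⁅A.e₃, y⁆ = -A.e₂ := by rw [← lie_skew, hye₃]
    simp only [v, Matrix.cons_val, add_lie, lie_sub, lie_smul, smul_lie, hb, hxe₃, hy₃, lie_self]
    module
  rintro _ ⟨i, rfl⟩ _ ⟨j, rfl⟩
  fin_cases i <;> fin_cases j
  exacts [lie_self _, h01, hskew _ _ h20, hskew _ _ h30, hskew _ _ h01, lie_self _, hskew _ _ h21,
    hskew _ _ h31, h20, h21, lie_self _, h23, h30, h31, hskew _ _ h23, lie_self _]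

end AbelianFlag

end Flag

/-! ### Linear relations between matrix entries -/

section Relations

open Module

variable {k L : Type*} [Field k] [LieRing L] [LieAlgebra k L]

lemma exists_linear_relation {m : ℕ} (Φ : L →ₗ[k] (Fin m → k))
    (h : LinearMap.range Φ ≠ ⊤) :
    ∃ c : Fin m → k, c ≠ 0 ∧ ∀ x, ∑ i, Φ x i * c i = 0 := by
  obtain ⟨f, hf, hfr⟩ := Submodule.exists_dual_map_eq_bot_of_lt_top h.lt_top inferInstance
  refine ⟨fun i ↦ f (fun j ↦ if i = j then 1 else 0), fun h0 ↦ hf ?_, fun x ↦ ?_⟩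
  · refine LinearMap.ext fun x ↦ ?_
    rw [LinearMap.pi_apply_eq_sum_univ f]
    simp [congrFun h0]
  · have : f (Φ x) = 0 := by
      rw [← Submodule.mem_bot k, ← hfr]
      exact Submodule.mem_map_of_mem (LinearMap.mem_range_self Φ x)
    rwa [LinearMap.pi_apply_eq_sum_univ f] at this

/-- The range has codimension at most one and lies in the hyperplane defined by c, hence equals it.
This lets matrix entries be prescribed subject to a single relation. -/
lemma exists_apply_eq_of_relation {m : ℕ} {Φ : L →ₗ[k] (Fin m → k)}
    (h : m ≤ finrank k (LinearMap.range Φ) + 1) {c : Fin m → k} (hc : c ≠ 0)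
    (hΦ : ∀ x, ∑ i, Φ x i * c i = 0) {p : Fin m → k} (hp : ∑ i, p i * c i = 0) :
    ∃ x, Φ x = p := by
  let f : Dual k (Fin m → k) := ∑ i, c i • LinearMap.proj i
  have hfa : ∀ p, f p = ∑ i, p i * c i := fun p ↦ by simp [f, mul_comm]
  have hf : f ≠ 0 := by
    obtain ⟨i, hi⟩ := Function.ne_iff.mp hc
    intro h0
    refine hi ?_
    have := hfa (Pi.single i 1)
    simpa [h0, Pi.single_apply] using this.symm
  have hle : LinearMap.range Φ ≤ LinearMap.ker f := by
    rintro _ ⟨x, rfl⟩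
    rw [LinearMap.mem_ker, hfa, hΦ]
  have hd := Module.Dual.finrank_ker_add_one_of_ne_zero hf
  rw [finrank_fin_fun] at hd
  have heq := Submodule.eq_of_le_of_finrank_le hle (by omega)
  have : p ∈ LinearMap.range Φ := by rw [heq, LinearMap.mem_ker, hfa, hp]
  exact this

namespace AbelianFlag

variable (A : AbelianFlag k L)

/-- The underlying subspace of the ideal. -/
def span : Submodule k L := Submodule.span k (Set.range ![A.e₁, A.e₂, A.e₃])

lemma finrank_span : finrank k A.span = 3 :=
  (finrank_span_eq_card A.linearIndependent).trans (Fintype.card_fin 3)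

lemma mem_span {x : L} : x ∈ A.span ↔ ∃ a b c : k, x = a • A.e₁ + b • A.e₂ + c • A.e₃ := by
  rw [span, Submodule.mem_span_range_iff_exists_fun]
  constructor
  · rintro ⟨c, rfl⟩
    exact ⟨c 0, c 1, c 2, by simp [Fin.sum_univ_three]⟩
  · rintro ⟨a, b, c, rfl⟩
    exact ⟨![a, b, c], by simp [Fin.sum_univ_three]⟩

/-- If the index is at least three, every functional is degenerate on `L × A`. -/
lemma exists_relation_of_three_le_index [FiniteDimensional k L] (hn : finrank k L = 7)
    (hi : 3 ≤ index k L) (ξ : Dual k L) :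
    ∃ a b c : k, ¬(a = 0 ∧ b = 0 ∧ c = 0) ∧
      ∀ x : L, a * ξ ⁅x, A.e₁⁆ + b * ξ ⁅x, A.e₂⁆ + c * ξ ⁅x, A.e₃⁆ = 0 := by
  let v : Fin 3 → L := ![A.e₁, A.e₂, A.e₃]
  let Φ : L →ₗ[k] (Fin 3 → k) := LinearMap.pi fun i ↦ (bracketForm ξ).flip (v i)
  by_cases hΦ : LinearMap.range Φ = ⊤
  · have hr := Φ.finrank_range_add_finrank_ker
    rw [hΦ, finrank_top, finrank_fin_fun, hn] at hr
    -- The kernel has dimension 4 and contains both the stabilizer, of dimension at least 3, and A,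
    -- of dimension 3. They intersect, and a common vector is a relation.
    have hle : stabilizer k ξ ⊔ A.span ≤ LinearMap.ker Φ := by
      refine sup_le (fun w hw ↦ ?_) ?_
      · ext i
        exact hw (v i)
      · intro w hw
        obtain ⟨a, b, c, rfl⟩ := A.mem_span.mp hw
        ext i
        fin_cases i <;>
          simp [Φ, v, A.lie₁₂, A.lie₁₃, A.lie₂₃, A.lie_e₂₁, A.lie_e₃₁, A.lie_e₃₂]
    have h1 := Submodule.finrank_mono hle
    have h2 := Submodule.finrank_sup_add_finrank_inf_eq (stabilizer k ξ) A.span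
    have h3 := index_le ξ
    rw [A.finrank_span] at h2
    have hne : stabilizer k ξ ⊓ A.span ≠ ⊥ := by
      intro h0
      rw [h0, finrank_bot] at h2
      omega
    obtain ⟨w, ⟨hws, hwA⟩, hw0⟩ := Submodule.exists_mem_ne_zero_of_ne_bot hne
    obtain ⟨a, b, c, rfl⟩ := A.mem_span.mp hwA
    refine ⟨a, b, c, ?_, fun x ↦ ?_⟩
    · rintro ⟨rfl, rfl, rfl⟩
      simp at hw0
    · have := hws x
      rw [← lie_skew, map_neg, neg_eq_zero] at this
      simpa using this
  · obtain ⟨c, hc, h⟩ := exists_linear_relation Φ hΦ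
    refine ⟨c 0, c 1, c 2, ?_, fun x ↦ ?_⟩
    · rintro ⟨h0, h1, h2⟩
      refine hc (funext fun i ↦ ?_)
      fin_cases i
      exacts [h0, h1, h2]
    · have := h x
      simp only [Fin.sum_univ_three] at this
      rw [← this]
      simp [Φ, v, mul_comm]

/-- If the flag does not start with a central element, then `E₁₃`, `E₂₃`, `E₃₃` all act. -/
lemma exists_actsBy_of_q₁₁_ne_zero [FiniteDimensional k L] [CharZero k] (hn : finrank k L = 7)
    (hi : 3 ≤ index k L) {x₀ : L} (hx₀ : A.q₁₁ x₀ ≠ 0) :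
    (∃ x, A.ActsBy x 0 0 1 0 0 0) ∧ (∃ x, A.ActsBy x 0 0 0 0 1 0) ∧
      ∃ x, A.ActsBy x 0 0 0 0 0 1 := by
  -- Otherwise, for suitable ξ, the pairing of x₀, p, w with e₁, e₂, e₃ is triangular with nonzero
  -- diagonal, contradicting the degeneracy on L × A.
  have hvan : ∀ p, A.q₁₁ p = 0 → A.q₁₂ p = 0 ∧ A.q₂₂ p = 0 := by
    intro p hp
    by_contra hne
    obtain ⟨w, hwA, w11, w12, w22⟩ : ∃ w, w ∉ A.span ∧ A.q₁₁ w = 0 ∧ A.q₁₂ w = 0 ∧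
        A.q₂₂ w = 0 := by
      let Φ : L →ₗ[k] (Fin 3 → k) := LinearMap.pi ![A.q₁₁, A.q₁₂, A.q₂₂]
      have hr := Φ.finrank_range_add_finrank_ker
      have hr' := Submodule.finrank_le (LinearMap.range Φ)
      rw [finrank_fin_fun] at hr'
      have hnle : ¬ LinearMap.ker Φ ≤ A.span := by
        intro hle
        have := Submodule.finrank_mono hle
        rw [A.finrank_span] at this
        omega
      obtain ⟨w, hw, hwA⟩ := SetLike.not_le_iff_exists.mp hnle
      exact ⟨w, hwA, congrFun hw 0, congrFun hw 1, congrFun hw 2⟩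
    have H : ∀ s r, A.q₁₂ p + s * A.q₂₂ p ≠ 0 →
        A.q₁₃ w + s * A.q₂₃ w + r * A.q₃₃ w = 0 := by
      intro s r hs
      obtain ⟨ξ, hξ⟩ := exists_dual_apply_eq A.linearIndependent ![1, s, r]
      have h1 : ξ A.e₁ = 1 := hξ 0
      have h2 : ξ A.e₂ = s := hξ 1
      have h3 : ξ A.e₃ = r := hξ 2
      obtain ⟨a, b, c, habc, h⟩ := A.exists_relation_of_three_le_index hn hi ξ
      simp only [A.lie_e₁, A.lie_e₂, A.lie_e₃, map_add, map_smul, smul_eq_mul, h1, h2, h3] at h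
      have hw := h w
      have hp' := h p
      have hx := h x₀
      rw [w11, w12, w22] at hw
      rw [hp] at hp'
      have hw' : c * (A.q₁₃ w + s * A.q₂₃ w + r * A.q₃₃ w) = 0 := by linear_combination hw
      refine (mul_eq_zero.mp hw').resolve_left fun hc ↦ habc ?_
      subst hc
      have hb : b = 0 := (mul_eq_zero.mp (show b * (A.q₁₂ p + s * A.q₂₂ p) = 0 by
        linear_combination hp')).resolve_right hs
      subst hb
      exact ⟨(mul_eq_zero.mp (show a * A.q₁₁ x₀ = 0 by linear_combination hx)).resolve_right hx₀,
        rfl, rfl⟩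
    obtain ⟨s, h1, h2⟩ : ∃ s, A.q₁₂ p + s * A.q₂₂ p ≠ 0 ∧ A.q₁₂ p + (s + 1) * A.q₂₂ p ≠ 0 := by
      by_cases h22 : A.q₂₂ p = 0
      · have : A.q₁₂ p ≠ 0 := fun h ↦ hne ⟨h, h22⟩
        exact ⟨0, by simpa [h22], by simpa [h22]⟩
      -- With this s the two values are `A.q₂₂ p` and twice it.
      · refine ⟨1 - A.q₁₂ p / A.q₂₂ p, ?_, ?_⟩
        · convert h22 using 1
          field_simp
          ring
        · convert mul_ne_zero two_ne_zero h22 using 1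
          field_simp
          ring
    have e1 := H s 0 h1
    have e2 := H s 1 h1
    have e3 := H (s + 1) 0 h2
    have w33 : A.q₃₃ w = 0 := by linear_combination e2 - e1
    have w23 : A.q₂₃ w = 0 := by linear_combination e3 - e1
    have w13 : A.q₁₃ w = 0 := by linear_combination e1 - s * w23
    exact hwA (A.mem_span.mpr (A.selfCentralizing w w11 w12 w13 w22 w23 w33))
  -- By `hvan` these four entries determine x modulo A, and L/A has dimension 4, so they take
  -- arbitrary values.
  let Ψ : L →ₗ[k] (Fin 4 → k) := LinearMap.pi ![A.q₁₁, A.q₁₃, A.q₂₃, A.q₃₃]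
  have hker : LinearMap.ker Ψ ≤ A.span := by
    intro w hw
    have h11 : A.q₁₁ w = 0 := congrFun hw 0
    exact A.mem_span.mpr (A.selfCentralizing w h11 (hvan w h11).1 (congrFun hw 1)
      (hvan w h11).2 (congrFun hw 2) (congrFun hw 3))
  have hsurj : Function.Surjective Ψ := by
    rw [← LinearMap.range_eq_top]
    apply Submodule.eq_top_of_finrank_eq
    have h1 := Ψ.finrank_range_add_finrank_ker
    have h2 := Submodule.finrank_mono hker
    have h3 := Submodule.finrank_le (LinearMap.range Ψ)
    rw [A.finrank_span] at h2
    rw [finrank_fin_fun] at h3 ⊢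
    omega
  have key : ∀ a b c : k, ∃ x, A.ActsBy x 0 0 a 0 b c := by
    intro a b c
    obtain ⟨x, hx⟩ := hsurj ![0, a, b, c]
    have h11 : A.q₁₁ x = 0 := congrFun hx 0
    exact ⟨x, h11, (hvan x h11).1, congrFun hx 1, (hvan x h11).2, congrFun hx 2, congrFun hx 3⟩
  exact ⟨key 1 0 0, key 0 1 0, key 0 0 1⟩

end AbelianFlag

end Relations

/-! ### The quasi quadratic case -/

section QuasiQuadratic

open Module

variable {k L : Type*} [Field k] [LieRing L] [LieAlgebra k L]

namespace AbelianFlag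

variable (A : AbelianFlag k L)

/-- If `e₁` is central, `E₁₂` and `E₁₃` act on the ideal and some element acts invertibly modulo
`e₁`, then every functional with `ξ e₁ ≠ 0` is regular and their stabilizers span `L`. -/
lemma isQuasiQuadratic_of_actsBy [FiniteDimensional k L] (hn : finrank k L = 7)
    (hi : index k L = 3) (h₁₁ : ∀ x, A.q₁₁ x = 0) {x y : L}
    (hx : A.ActsBy x 0 1 0 0 0 0) (hy : A.ActsBy y 0 0 1 0 0 0) (t : L)
    (ht₂ : A.q₂₂ t ≠ 0) (ht₃ : A.q₃₃ t ≠ 0) : IsQuasiQuadratic k L := by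
  obtain ⟨-, x12, x13, x22, x23, x33⟩ := hx
  obtain ⟨-, y12, y13, y22, y23, y33⟩ := hy
  have he₁ : ∀ z, ⁅z, A.e₁⁆ = 0 := fun z ↦ by rw [A.lie_e₁, h₁₁, zero_smul]
  have hxe₂ : ⁅x, A.e₂⁆ = A.e₁ := by simp [A.lie_e₂, *]
  have hxe₃ : ⁅x, A.e₃⁆ = 0 := by simp [A.lie_e₃, *]
  have hye₂ : ⁅y, A.e₂⁆ = 0 := by simp [A.lie_e₂, *]
  have hye₃ : ⁅y, A.e₃⁆ = A.e₁ := by simp [A.lie_e₃, *]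
  have he₁' : ∀ z : L, ⁅A.e₁, z⁆ = 0 := fun z ↦ by rw [← lie_skew, he₁, neg_zero]
  have he₂x : ⁅A.e₂, x⁆ = -A.e₁ := by rw [← lie_skew, hxe₂]
  have he₂y : ⁅A.e₂, y⁆ = 0 := by rw [← lie_skew, hye₂, neg_zero]
  have he₃x : ⁅A.e₃, x⁆ = 0 := by rw [← lie_skew, hxe₃, neg_zero]
  have he₃y : ⁅A.e₃, y⁆ = -A.e₁ := by rw [← lie_skew, hye₃]
  obtain ⟨d₁, d₂, d₃, hd⟩ := A.exists_eq_of_actsBy_zero (x := ⁅x, y⁆) <| by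
    simp [ActsBy, A.q_lie_e₂, A.q_lie_e₃, *]
  have hd' : ⁅y, x⁆ = -(d₁ • A.e₁ + d₂ • A.e₂ + d₃ • A.e₃) := by rw [← lie_skew, hd]
  obtain ⟨p₁, p₂, p₃, hp⟩ := A.exists_eq_of_actsBy_zero
      (x := ⁅t, x⁆ - (-A.q₂₂ t • x - A.q₂₃ t • y)) <| by
    simp [ActsBy, A.q_lie_e₂, A.q_lie_e₃, *]
  obtain ⟨r₁, r₂, r₃, hr⟩ := A.exists_eq_of_actsBy_zero
      (x := ⁅t, y⁆ - (-A.q₃₃ t • y)) <| by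
    simp [ActsBy, A.q_lie_e₂, A.q_lie_e₃, *]
  rw [sub_eq_iff_eq_add] at hp hr
  let v : Fin 5 → L := ![A.e₁, A.e₂, A.e₃, x, y]
  have hv : LinearIndependent k v := by
    rw [Fintype.linearIndependent_iff]
    intro g hg
    simp only [v, Fin.sum_univ_five, Matrix.cons_val] at hg
    have h3 : g 3 = 0 := by
      have := congrArg A.q₁₂ hg
      simpa [A.q_e₁, A.q_e₂, A.q_e₃, x12, y12] using this
    have h4 : g 4 = 0 := by
      have := congrArg A.q₁₃ hg
      simpa [A.q_e₁, A.q_e₂, A.q_e₃, x13, y13] using this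
    have := A.eq_zero_of_sum_eq_zero (a := g 0) (b := g 1) (c := g 2)
      (by simpa [h3, h4] using hg)
    intro i
    fin_cases i
    exacts [this.1, this.2.1, this.2.2, h3, h4]
  let M : Submodule k L := Submodule.span k (Set.range v)
  have hM : finrank k M = 5 := (finrank_span_eq_card hv).trans (Fintype.card_fin 5)
  have hmemM : ∀ {m}, m ∈ M → ∃ a₁ a₂ a₃ c₁ c₂ : k,
      m = a₁ • A.e₁ + a₂ • A.e₂ + a₃ • A.e₃ + c₁ • x + c₂ • y := by
    intro m hm
    obtain ⟨c, rfl⟩ := (Submodule.mem_span_range_iff_exists_fun k).mp hm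
    exact ⟨c 0, c 1, c 2, c 3, c 4, by simp [v, Fin.sum_univ_five]⟩
  have he₁0 : A.e₁ ≠ 0 := A.linearIndependent.ne_zero 0
  have hreg : ∀ ξ : Dual k L, ξ A.e₁ = 1 →
      IsRegularFunctional k ξ ∧ stabilizer k ξ ⊔ M = ⊤ := by
    intro ξ hξ
    -- On M the form pairs e₂ with x and e₃ with y through ξ(e₁) = 1, so its radical there is the
    -- line of e₁. Counting dimensions gives dim L(ξ) ≤ 3 and L(ξ) + M = L.
    have hinf : stabilizer k ξ ⊓ M ≤ k ∙ A.e₁ := by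
      rintro m ⟨hms, hmM⟩
      obtain ⟨a₁, a₂, a₃, c₁, c₂, rfl⟩ := hmemM hmM
      have g1 := hms A.e₂
      have g2 := hms A.e₃
      have g3 := hms x
      have g4 := hms y
      simp only [add_lie, smul_lie, he₁', lie_self, A.lie₂₃, A.lie_e₃₂, hxe₂, hxe₃, hye₂, hye₃,
        he₂x, he₂y, he₃x, he₃y, map_add, map_smul, map_neg, map_zero, smul_eq_mul, hξ, hd, hd']
        at g1 g2 g3 g4
      have hc₁ : c₁ = 0 := by linear_combination g1
      have hc₂ : c₂ = 0 := by linear_combination g2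
      subst hc₁ hc₂
      have ha₂ : a₂ = 0 := by linear_combination -g3
      have ha₃ : a₃ = 0 := by linear_combination -g4
      subst ha₂ ha₃
      exact Submodule.mem_span_singleton.mpr ⟨a₁, by module⟩
    have h1 := Submodule.finrank_mono hinf
    rw [finrank_span_singleton he₁0] at h1
    have h2 := Submodule.finrank_sup_add_finrank_inf_eq (stabilizer k ξ) M
    have h3 := index_le ξ
    have h4 := Submodule.finrank_le (stabilizer k ξ ⊔ M)
    refine ⟨?_, Submodule.eq_top_of_finrank_eq ?_⟩
    · unfold IsRegularFunctional
      omega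
    · omega
  have hF : ∀ ξ : Dual k L, ξ A.e₁ = 1 → stabilizer k ξ ≤ frobeniusSemiradical k L :=
    fun ξ hξ ↦ le_iSup₂_of_le ξ (hreg ξ hξ).1 le_rfl
  -- For ξ = (1, s₂, s₃, u₁, u₂) on the basis of M, L(ξ) contains a translate of t by e₂, e₃, x, y.
  -- Pairing it with e₂, e₃, x, y determines the coefficients.
  have key : ∀ s₂ s₃ u₁ u₂ : k, ∃ a₂ a₃ c₁ c₂ : k,
      t + a₂ • A.e₂ + a₃ • A.e₃ + c₁ • x + c₂ • y ∈ frobeniusSemiradical k L ∧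
      c₁ = -(A.q₁₂ t + A.q₂₂ t * s₂) ∧ c₂ = -(A.q₁₃ t + A.q₂₃ t * s₂ + A.q₃₃ t * s₃) ∧
      a₂ = -A.q₂₂ t * u₁ - A.q₂₃ t * u₂ + (p₁ + p₂ * s₂ + p₃ * s₃)
        - c₂ * (d₁ + d₂ * s₂ + d₃ * s₃) ∧
      a₃ = -A.q₃₃ t * u₂ + (r₁ + r₂ * s₂ + r₃ * s₃) + c₁ * (d₁ + d₂ * s₂ + d₃ * s₃) := by
    intro s₂ s₃ u₁ u₂
    obtain ⟨ξ, hξ⟩ := exists_dual_apply_eq hv ![1, s₂, s₃, u₁, u₂]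
    have ξ1 : ξ A.e₁ = 1 := hξ 0
    have ξ2 : ξ A.e₂ = s₂ := hξ 1
    have ξ3 : ξ A.e₃ = s₃ := hξ 2
    have ξx : ξ x = u₁ := hξ 3
    have ξy : ξ y = u₂ := hξ 4
    obtain ⟨s, hs, m, hm, hsm⟩ := Submodule.mem_sup.mp
      (show t ∈ stabilizer k ξ ⊔ M by rw [(hreg ξ ξ1).2]; trivial)
    obtain ⟨a₁, a₂, a₃, c₁, c₂, rfl⟩ := hmemM hm
    have he₁s : A.e₁ ∈ stabilizer k ξ := fun z ↦ by rw [he₁', map_zero]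
    have hs' : t + (-a₂) • A.e₂ + (-a₃) • A.e₃ + (-c₁) • x + (-c₂) • y ∈ stabilizer k ξ := by
      convert add_mem hs (Submodule.smul_mem _ a₁ he₁s) using 1
      rw [← hsm]
      module
    have g1 := hs' A.e₂
    have g2 := hs' A.e₃
    have g3 := hs' x
    have g4 := hs' y
    simp only [add_lie, smul_lie, lie_self, A.lie₂₃, A.lie_e₃₂, hxe₂, hxe₃, hye₂, hye₃,
      he₂x, he₂y, he₃x, he₃y, map_add, map_sub, map_smul, map_neg, map_zero, smul_eq_mul, hd, hd',
      hp, hr, A.lie_e₂ t, A.lie_e₃ t, ξ1, ξ2, ξ3, ξx, ξy] at g1 g2 g3 g4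
    refine ⟨-a₂, -a₃, -c₁, -c₂, hF ξ ξ1 hs', ?_, ?_, ?_, ?_⟩
    · linear_combination g1
    · linear_combination g2
    · linear_combination -g3
    · linear_combination -g4
  set F := frobeniusSemiradical k L
  have cancel : ∀ {c : k} {z : L}, c ≠ 0 → c • z ∈ F → z ∈ F := fun hc h ↦
    (Submodule.smul_mem_iff F hc).mp h
  -- Changing one parameter at a time and subtracting this base element isolates e₂, e₃, y, x in
  -- turn; the leading factors are -t₂₂ or -t₃₃.
  obtain ⟨a₂, a₃, _, _, hw, rfl, rfl, ha₂, ha₃⟩ := key 0 0 0 0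
  have h2 : A.e₂ ∈ F := by
    obtain ⟨_, _, _, _, hw', rfl, rfl, rfl, rfl⟩ := key 0 0 1 0
    refine cancel (neg_ne_zero.mpr ht₂) ?_
    convert sub_mem hw' hw using 1
    rw [ha₂, ha₃]
    module
  have h3 : A.e₃ ∈ F := by
    obtain ⟨_, _, _, _, hw', rfl, rfl, rfl, rfl⟩ := key 0 0 0 1
    refine cancel (neg_ne_zero.mpr ht₃) ?_
    convert add_mem (sub_mem hw' hw) (F.smul_mem (A.q₂₃ t) h2) using 1
    rw [ha₂, ha₃]
    module
  have mod23 : ∀ {z : L} (a b : k), z + a • A.e₂ + b • A.e₃ ∈ F → z ∈ F := by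
    intro z a b h
    convert sub_mem (sub_mem h (F.smul_mem b h3)) (F.smul_mem a h2) using 1
    module
  have hyF : y ∈ F := by
    obtain ⟨a, b, _, _, hw', rfl, rfl, -, -⟩ := key 0 1 0 0
    refine cancel (neg_ne_zero.mpr ht₃) (mod23 (a - a₂) (b - a₃) ?_)
    convert sub_mem hw' hw using 1
    module
  have hxF : x ∈ F := by
    obtain ⟨a, b, _, _, hw', rfl, rfl, -, -⟩ := key 1 0 0 0
    refine cancel (neg_ne_zero.mpr ht₂) (mod23 (a - a₂) (b - a₃) ?_)
    convert add_mem (sub_mem hw' hw) (F.smul_mem (A.q₂₃ t) hyF) using 1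
    module
  obtain ⟨ξ, hξ⟩ := exists_dual_apply_eq hv ![1, 0, 0, 0, 0]
  have ξ1 : ξ A.e₁ = 1 := hξ 0
  have h1 : A.e₁ ∈ F := hF ξ ξ1 fun z ↦ by rw [he₁', map_zero]
  refine top_le_iff.mp ?_
  rw [← (hreg ξ ξ1).2]
  refine sup_le (hF ξ ξ1) (Submodule.span_le.mpr ?_)
  rintro _ ⟨i, rfl⟩
  fin_cases i
  exacts [h1, h2, h3, hxF, hyF]

end AbelianFlag

end QuasiQuadratic

/-! ### Four-dimensional triangular algebras and the dimension bounds -/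

section Classification

open Module

variable {k L : Type*} [Field k] [LieRing L] [LieAlgebra k L]

lemma AbelianFlag.exists_commuting [FiniteDimensional k L] [CharZero k] (A : AbelianFlag k L)
    (hn : finrank k L = 7) (hi : index k L = 3) (hq : ¬ IsQuasiQuadratic k L) :
    ∃ H : Submodule k L, (∀ x ∈ H, ∀ y ∈ H, ⁅x, y⁆ = 0) ∧ 4 ≤ finrank k H := by
  by_cases h₁₁ : ∀ x, A.q₁₁ x = 0
  swap
  · push Not at h₁₁
    obtain ⟨x₀, hx₀⟩ := h₁₁
    obtain ⟨⟨x, hx⟩, ⟨y, hy⟩, t, ht⟩ := A.exists_actsBy_of_q₁₁_ne_zero hn hi.ge hx₀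
    exact A.exists_commuting_of_actsBy hx hy t (by simp [ht.1, ht.2.2.2.1, ht.2.2.2.2.2])
  let Φ : L →ₗ[k] (Fin 5 → k) := LinearMap.pi ![A.q₁₂, A.q₁₃, A.q₂₂, A.q₂₃, A.q₃₃]
  have hker : LinearMap.ker Φ = A.span := by
    apply le_antisymm
    · intro w hw
      exact A.mem_span.mpr (A.selfCentralizing w (h₁₁ w) (congrFun hw 0) (congrFun hw 1)
        (congrFun hw 2) (congrFun hw 3) (congrFun hw 4))
    · intro w hw
      obtain ⟨a, b, c, rfl⟩ := A.mem_span.mp hw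
      ext i
      fin_cases i <;> simp [Φ, A.q_e₁, A.q_e₂, A.q_e₃]
  have hr := Φ.finrank_range_add_finrank_ker
  rw [hker, A.finrank_span, hn] at hr
  -- With q₁₁ = 0, L/A is a hyperplane in the 5-dimensional space of remaining entries: f is its
  -- only relation up to scalars.
  obtain ⟨f, hf, hrel⟩ := exists_linear_relation Φ fun h ↦ by
    rw [h, finrank_top, finrank_fin_fun] at hr
    omega
  have mk : ∀ a₁₂ a₁₃ a₂₂ a₂₃ a₃₃ : k,
      a₁₂ * f 0 + a₁₃ * f 1 + a₂₂ * f 2 + a₂₃ * f 3 + a₃₃ * f 4 = 0 →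
      ∃ x, A.ActsBy x 0 a₁₂ a₁₃ a₂₂ a₂₃ a₃₃ := by
    intro a₁₂ a₁₃ a₂₂ a₂₃ a₃₃ h
    obtain ⟨x, hx⟩ := exists_apply_eq_of_relation (Φ := Φ) (by omega) hf hrel
      (p := ![a₁₂, a₁₃, a₂₂, a₂₃, a₃₃]) (by simpa [Fin.sum_univ_five] using h)
    exact ⟨x, h₁₁ x, congrFun hx 0, congrFun hx 1, congrFun hx 2, congrFun hx 3, congrFun hx 4⟩
  have rel : ∀ x, A.q₁₂ x * f 0 + A.q₁₃ x * f 1 + A.q₂₂ x * f 2 + A.q₂₃ x * f 3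
      + A.q₃₃ x * f 4 = 0 := by
    intro x
    have := hrel x
    rw [Fin.sum_univ_five] at this
    exact this
  clear_value Φ
  -- Otherwise E₁₂ and E₂₃, corrected by multiples of E₁₃, both act; their commutator E₁₃ violates
  -- the relation.
  have hf₁ : f 1 = 0 := by
    by_contra hne
    obtain ⟨x, x11, x12, x13, x22, x23, x33⟩ := mk 1 (-(f 0 / f 1)) 0 0 0 (by field_simp; ring)
    obtain ⟨y, y11, y12, y13, y22, y23, y33⟩ := mk 0 (-(f 3 / f 1)) 0 1 0 (by field_simp; ring)
    have := rel ⁅x, y⁆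
    simp [A.q_lie_e₂, A.q_lie_e₃, *] at this
  by_cases hf₀ : f 0 = 0
  · obtain ⟨x, hx⟩ := mk 1 0 0 0 0 (by simp [hf₀])
    obtain ⟨y, hy⟩ := mk 0 1 0 0 0 (by simp [hf₁])
    have hY : ∀ t, A.q₂₂ t = 0 ∨ A.q₃₃ t = 0 := by
      intro t
      by_contra! h
      exact hq (A.isQuasiQuadratic_of_actsBy hn hi h₁₁ hx hy t h.1 h.2)
    -- Otherwise the relation could be solved for q₂₃, leaving q₂₂ = q₃₃ = 1 possible, against `hY`.
    have hf₃ : f 3 = 0 := by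
      by_contra hne
      obtain ⟨t, ht⟩ := mk 0 0 1 (-((f 2 + f 4) / f 3)) 1 (by field_simp; ring)
      have := hY t
      simp [ht.2.2.2.1, ht.2.2.2.2.2] at this
    obtain ⟨z, hz⟩ := mk 0 0 0 1 0 (by simp [hf₃])
    -- By `hY` exactly one of f 2 and f 4 vanishes, so t₂₂ = 3t₃₃ is impossible.
    obtain ⟨t, ht⟩ := mk 0 0 (f 4) 0 (-f 2) (by ring)
    have hfne : f 2 ≠ 0 ∨ f 4 ≠ 0 := by
      by_contra! h
      refine hf (funext fun i ↦ ?_)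
      fin_cases i
      exacts [hf₀, hf₁, h.1, hf₃, h.2]
    refine A.exists_commuting_of_actsBy hy hz t ?_
    have h := hY t
    rw [ht.2.2.2.1, ht.2.2.2.2.2, neg_eq_zero] at h
    rw [ht.1, ht.2.2.2.1, ht.2.2.2.2.2]
    rcases h with h | h <;> simp_all
  · obtain ⟨x, hx⟩ := mk 0 1 0 0 0 (by simp [hf₁])
    -- Commutators must satisfy the relation: here [s, t] acts as (f 4 / f 0)E₁₂, and for `hf₃` as
    -- E₂₃.
    have hf₄ : f 4 = 0 := by
      obtain ⟨s, s11, s12, s13, s22, s23, s33⟩ := mk (-(f 2 / f 0)) 0 1 0 0 (by field_simp; ring)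
      obtain ⟨t, t11, t12, t13, t22, t23, t33⟩ := mk (-(f 4 / f 0)) 0 0 0 1 (by field_simp; ring)
      have := rel ⁅s, t⁆
      simpa [A.q_lie_e₂, A.q_lie_e₃, *] using this
    obtain ⟨t, ht⟩ := mk 0 0 0 0 1 (by simp [hf₄])
    have hf₃ : f 3 = 0 := by
      obtain ⟨t11, t12, t13, t22, t23, t33⟩ := ht
      obtain ⟨s, s11, s12, s13, s22, s23, s33⟩ := mk (-(f 3 / f 0)) 0 0 1 0 (by field_simp; ring)
      have := rel ⁅s, t⁆
      simpa [A.q_lie_e₂, A.q_lie_e₃, *] using this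
    obtain ⟨y, hy⟩ := mk 0 0 0 1 0 (by simp [hf₃])
    exact A.exists_commuting_of_actsBy hx hy t (by simp [ht.1, ht.2.2.2.1, ht.2.2.2.2.2])

lemma exists_succ_of_finrank_lt [IsAlgClosed k] [CharZero k] [FiniteDimensional k L]
    [LieAlgebra.IsSolvable L] {N A : LieIdeal k L} (hNA : N ≤ A)
    (h : finrank k N < finrank k A) :
    ∃ (N' : LieIdeal k L) (x : L), N' ≤ A ∧ finrank k N' = finrank k N + 1 ∧
      ∀ z, z ∈ N' ↔ ∃ n ∈ N, ∃ c : k, n + c • x = z := by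
  obtain ⟨x, hxA, hxN, χ, hχ⟩ := exists_eigenvector_mod
    (lt_of_le_of_ne hNA fun h' ↦ by rw [h'] at h; exact lt_irrefl _ h)
  refine ⟨adjoinEigenvector N x χ hχ, x, ?_, finrank_adjoinEigenvector hxN,
    fun z ↦ mem_adjoinEigenvector⟩
  intro z hz
  obtain ⟨n, hn, c, rfl⟩ := mem_adjoinEigenvector.mp hz
  exact A.add_mem (hNA hn) (A.smul_mem c hxA)

lemma finrank_le_add_of_apply_eq_zero [FiniteDimensional k L] {A : LieIdeal k L} {m : ℕ}
    (Φ : L →ₗ[k] (Fin m → k)) (h : ∀ x, Φ x = 0 → x ∈ A) :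
    finrank k L ≤ m + finrank k A := by
  have h1 := Φ.finrank_range_add_finrank_ker
  have h2 := Submodule.finrank_le (LinearMap.range Φ)
  have h3 : finrank k (LinearMap.ker Φ) ≤ finrank k A :=
    Submodule.finrank_mono (t := A.toSubmodule) h
  rw [finrank_fin_fun] at h2
  omega

lemma LieIdeal.eq_of_le_of_finrank_eq [FiniteDimensional k L] {N A : LieIdeal k L} (h : N ≤ A)
    (hd : finrank k N = finrank k A) : N = A :=
  LieSubmodule.toSubmodule_injective (Submodule.eq_of_le_of_finrank_eq (S₂ := A.toSubmodule) h hd)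

/-! ### Invariant flags in a self-centralizing ideal -/

section SelfCentralizing

variable [IsAlgClosed k] [CharZero k] [FiniteDimensional k L] [LieAlgebra.IsSolvable L]
  {A : LieIdeal k L}

lemma exists_flag_one (hA : 1 ≤ finrank k A) :
    ∃ (N : LieIdeal k L) (e₁ : L), N ≤ A ∧ finrank k N = 1 ∧ ∀ z, z ∈ N ↔ ∃ a : k, z = a • e₁ := by
  have h0 : finrank k (⊥ : LieIdeal k L) = 0 := finrank_bot k L
  obtain ⟨N, e₁, hN, hd, hmem⟩ := exists_succ_of_finrank_lt (bot_le (a := A)) (by omega)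
  exact ⟨N, e₁, hN, by omega, fun z ↦ by simp [hmem, eq_comm]⟩

lemma exists_flag_two (hA : 2 ≤ finrank k A) :
    ∃ (N₁ N₂ : LieIdeal k L) (e₁ e₂ : L), N₂ ≤ A ∧ finrank k N₂ = 2 ∧
      (∀ z, z ∈ N₁ ↔ ∃ a : k, z = a • e₁) ∧
      ∀ z, z ∈ N₂ ↔ ∃ a b : k, z = a • e₁ + b • e₂ := by
  obtain ⟨N₁, e₁, hN₁, hd₁, hmem₁⟩ := exists_flag_one (k := k) (A := A) (by omega)
  obtain ⟨N₂, e₂, hN₂, hd₂, hmem₂⟩ := exists_succ_of_finrank_lt hN₁ (by omega)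
  refine ⟨N₁, N₂, e₁, e₂, hN₂, by omega, hmem₁, fun z ↦ ?_⟩
  simp only [hmem₂, hmem₁]
  constructor
  · rintro ⟨_, ⟨a, rfl⟩, b, rfl⟩
    exact ⟨a, b, rfl⟩
  · rintro ⟨a, b, rfl⟩
    exact ⟨_, ⟨a, rfl⟩, b, rfl⟩

/-- Dimension bounds for a self-centralizing ideal of a solvable Lie algebra. -/
lemma finrank_bounds (hC : ∀ x, (∀ y ∈ A, ⁅x, y⁆ = 0) → x ∈ A) :
    (1 ≤ finrank k L → 1 ≤ finrank k A) ∧ (3 ≤ finrank k L → 2 ≤ finrank k A) ∧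
      (6 ≤ finrank k L → 3 ≤ finrank k A) := by
  -- The bounds 0, 2, 5 are d + d(d+1)/2 for d = 0, 1, 2: an element whose upper triangular entries
  -- on A all vanish centralizes A, hence lies in A.
  have h0 : finrank k A = 0 → finrank k L ≤ 0 := by
    intro hA
    have hbot : (⊥ : LieIdeal k L) = A :=
      LieIdeal.eq_of_le_of_finrank_eq bot_le ((finrank_bot k L).trans hA.symm)
    have := finrank_le_add_of_apply_eq_zero (A := A) (0 : L →ₗ[k] (Fin 0 → k)) fun x _ ↦
      hC x fun y hy ↦ by
        rw [← hbot, LieSubmodule.mem_bot] at hy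
        rw [hy, lie_zero]
    omega
  have h1 : finrank k A = 1 → finrank k L ≤ 2 := by
    intro hA
    obtain ⟨N, e₁, hN, hd, hmem⟩ := exists_flag_one (k := k) (A := A) hA.ge
    obtain rfl := LieIdeal.eq_of_le_of_finrank_eq hN (hd.trans hA.symm)
    have he0 : e₁ ≠ 0 := by
      rintro rfl
      have : N = ⊥ := by
        rw [LieSubmodule.eq_bot_iff]
        intro z hz
        obtain ⟨a, rfl⟩ := (hmem z).mp hz
        exact smul_zero a
      rw [this] at hA
      exact zero_ne_one ((finrank_bot k L).symm.trans hA)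
    obtain ⟨f, hf⟩ := exists_dual_apply_eq
      (LinearIndependent.of_subsingleton (v := fun _ : Unit ↦ e₁) () he0) (fun _ ↦ (1 : k))
    replace hf : f e₁ = 1 := hf ()
    have := finrank_le_add_of_apply_eq_zero (A := N) (m := 1)
      (LinearMap.pi fun _ ↦ (bracketForm f).flip e₁) fun x hx ↦ hC x fun y hy ↦ by
        obtain ⟨a, rfl⟩ := (hmem y).mp hy
        obtain ⟨b, hb⟩ := (hmem _).mp (lie_mem_right k L N x e₁ ((hmem _).mpr ⟨1, by simp⟩))
        have : f ⁅x, e₁⁆ = 0 := congrFun hx 0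
        rw [hb, map_smul, hf, smul_eq_mul, mul_one] at this
        rw [lie_smul, hb, this, zero_smul, smul_zero]
    omega
  have h2 : finrank k A = 2 → finrank k L ≤ 5 := by
    intro hA
    obtain ⟨N, A', e₁, e₂, hN, hd, hmem₁, hmem₂⟩ := exists_flag_two (k := k) (A := A) hA.ge
    obtain rfl := LieIdeal.eq_of_le_of_finrank_eq hN (hd.trans hA.symm)
    have hli : LinearIndependent k ![e₁, e₂] := by
      rw [linearIndependent_iff_card_le_finrank_span, Fintype.card_fin]
      refine hA.ge.trans <| Submodule.finrank_mono (s := A'.toSubmodule) fun z hz ↦ ?_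
      obtain ⟨a, b, rfl⟩ := (hmem₂ z).mp hz
      exact (Submodule.mem_span_range_iff_exists_fun k).mpr ⟨![a, b], by simp⟩
    obtain ⟨f, hf⟩ := exists_dual_apply_eq hli ![1, 0]
    obtain ⟨g, hg⟩ := exists_dual_apply_eq hli ![0, 1]
    have f1 : f e₁ = 1 := hf 0
    have f2 : f e₂ = 0 := hf 1
    have g1 : g e₁ = 0 := hg 0
    have g2 : g e₂ = 1 := hg 1
    have := finrank_le_add_of_apply_eq_zero (A := A') (m := 3)
      (LinearMap.pi ![(bracketForm f).flip e₁, (bracketForm f).flip e₂, (bracketForm g).flip e₂])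
      fun x hx ↦ hC x fun y hy ↦ by
        have hx₁ : f ⁅x, e₁⁆ = 0 := congrFun hx 0
        have hx₂ : f ⁅x, e₂⁆ = 0 := congrFun hx 1
        have hx₃ : g ⁅x, e₂⁆ = 0 := congrFun hx 2
        obtain ⟨c, hc⟩ := (hmem₁ _).mp (lie_mem_right k L N x e₁ ((hmem₁ _).mpr ⟨1, by simp⟩))
        obtain ⟨d, d', hd⟩ :=
          (hmem₂ _).mp (lie_mem_right k L A' x e₂ ((hmem₂ _).mpr ⟨0, 1, by simp⟩))
        obtain ⟨a, b, rfl⟩ := (hmem₂ y).mp hy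
        simp [hc, f1] at hx₁
        simp [hd, f1, f2] at hx₂
        simp [hd, g1, g2] at hx₃
        simp [hc, hd, hx₁, hx₂, hx₃]
    omega
  refine ⟨fun h ↦ ?_, fun h ↦ ?_, fun h ↦ ?_⟩ <;> by_contra! hlt <;>
    obtain h' | h' | h' : finrank k A = 0 ∨ finrank k A = 1 ∨ finrank k A = 2 := by omega
  all_goals first
    | have := h0 h'; omega
    | have := h1 h'; omega
    | have := h2 h'; omega

lemma nonempty_abelianFlag (hA : ∀ x ∈ A, ∀ y ∈ A, ⁅x, y⁆ = 0)
    (hC : ∀ x, (∀ y ∈ A, ⁅x, y⁆ = 0) → x ∈ A) (hd : finrank k A = 3) :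
    Nonempty (AbelianFlag k L) := by
  obtain ⟨N₁, N₂, e₁, e₂, hN₂, hd₂, hmem₁, hmem₂⟩ := exists_flag_two (k := k) (A := A) (by omega)
  obtain ⟨A', e₃, hN₃, hd₃, hmem₃⟩ := exists_succ_of_finrank_lt hN₂ (by omega)
  obtain rfl := LieIdeal.eq_of_le_of_finrank_eq hN₃ (by omega)
  replace hmem₃ : ∀ z, z ∈ A' ↔ ∃ a b c : k, z = a • e₁ + b • e₂ + c • e₃ := by
    intro z
    simp only [hmem₃, hmem₂]
    constructor
    · rintro ⟨_, ⟨a, b, rfl⟩, c, rfl⟩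
      exact ⟨a, b, c, rfl⟩
    · rintro ⟨a, b, c, rfl⟩
      exact ⟨_, ⟨a, b, rfl⟩, c, rfl⟩
  have hli : LinearIndependent k ![e₁, e₂, e₃] := by
    rw [linearIndependent_iff_card_le_finrank_span, Fintype.card_fin]
    refine hd.ge.trans <| Submodule.finrank_mono (s := A'.toSubmodule) fun z hz ↦ ?_
    obtain ⟨a, b, c, rfl⟩ := (hmem₃ z).mp hz
    exact (Submodule.mem_span_range_iff_exists_fun k).mpr
      ⟨![a, b, c], by simp [Fin.sum_univ_three]⟩
  obtain ⟨f, hf⟩ := exists_dual_apply_eq hli ![1, 0, 0]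
  obtain ⟨g, hg⟩ := exists_dual_apply_eq hli ![0, 1, 0]
  obtain ⟨h, hh⟩ := exists_dual_apply_eq hli ![0, 0, 1]
  have f1 : f e₁ = 1 := hf 0
  have f2 : f e₂ = 0 := hf 1
  have f3 : f e₃ = 0 := hf 2
  have g1 : g e₁ = 0 := hg 0
  have g2 : g e₂ = 1 := hg 1
  have g3 : g e₃ = 0 := hg 2
  have h1 : h e₁ = 0 := hh 0
  have h2 : h e₂ = 0 := hh 1
  have h3 : h e₃ = 1 := hh 2
  have m1 : e₁ ∈ A' := (hmem₃ _).mpr ⟨1, 0, 0, by simp⟩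
  have m2 : e₂ ∈ A' := (hmem₃ _).mpr ⟨0, 1, 0, by simp⟩
  have m3 : e₃ ∈ A' := (hmem₃ _).mpr ⟨0, 0, 1, by simp⟩
  have l1 : ∀ x : L, ⁅x, e₁⁆ = f ⁅x, e₁⁆ • e₁ := by
    intro x
    obtain ⟨a, ha⟩ := (hmem₁ _).mp (lie_mem_right k L N₁ x e₁ ((hmem₁ _).mpr ⟨1, by simp⟩))
    simp [ha, f1]
  have l2 : ∀ x : L, ⁅x, e₂⁆ = f ⁅x, e₂⁆ • e₁ + g ⁅x, e₂⁆ • e₂ := by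
    intro x
    obtain ⟨a, b, ha⟩ := (hmem₂ _).mp (lie_mem_right k L N₂ x e₂ ((hmem₂ _).mpr ⟨0, 1, by simp⟩))
    simp [ha, f1, f2, g1, g2]
  have l3 : ∀ x : L, ⁅x, e₃⁆ = f ⁅x, e₃⁆ • e₁ + g ⁅x, e₃⁆ • e₂ + h ⁅x, e₃⁆ • e₃ := by
    intro x
    obtain ⟨a, b, c, ha⟩ := (hmem₃ _).mp (lie_mem_right k L A' x e₃ m3)
    simp [ha, f1, f2, f3, g1, g2, g3, h1, h2, h3]
  exact ⟨{
    e₁ := e₁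
    e₂ := e₂
    e₃ := e₃
    q₁₁ := (bracketForm f).flip e₁
    q₁₂ := (bracketForm f).flip e₂
    q₁₃ := (bracketForm f).flip e₃
    q₂₂ := (bracketForm g).flip e₂
    q₂₃ := (bracketForm g).flip e₃
    q₃₃ := (bracketForm h).flip e₃
    linearIndependent := hli
    lie₁₂ := hA _ m1 _ m2
    lie₁₃ := hA _ m1 _ m3
    lie₂₃ := hA _ m2 _ m3
    lie_e₁ := l1
    lie_e₂ := l2
    lie_e₃ := l3
    selfCentralizing := fun x q1 q2 q3 q4 q5 q6 ↦ by
      refine (hmem₃ x).mp (hC x fun y hy ↦ ?_)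
      obtain ⟨a, b, c, rfl⟩ := (hmem₃ y).mp hy
      change f ⁅x, _⁆ = 0 at q1 q2 q3
      change g ⁅x, _⁆ = 0 at q4 q5
      change h ⁅x, _⁆ = 0 at q6
      rw [lie_add, lie_add, lie_smul, lie_smul, lie_smul, l1, l2, l3, q1, q2, q3, q4, q5, q6]
      simp }⟩

end SelfCentralizing

/-- The half-dimension `m` of a generic coadjoint orbit, with the value of `c(L)` and an abelian
subspace when `m ≤ 1`. -/
lemma exists_eq_index_add [FiniteDimensional k L] [CharZero k] :
    ∃ m, finrank k L = index k L + 2 * m ∧ magicNumber k L = index k L + m ∧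
      (m ≤ 1 → HasRProperty k L) := by
  obtain ⟨ξ, hξ⟩ := exists_isRegularFunctional k L
  obtain ⟨m, hm⟩ := even_finrank_sub_finrank_stabilizer ξ
  have hξ' : finrank k (stabilizer k ξ) = index k L := hξ
  have hc : magicNumber k L = index k L + m := by
    rw [magicNumber, hm, hξ']
    push_cast
    ring
  refine ⟨m, by rw [hm, hξ'], hc, fun hm1 ↦ ?_⟩
  obtain rfl | rfl : m = 0 ∨ m = 1 := by omega
  · refine hasRProperty_of_commuting (stabilizer k ξ) (fun x _ y _ ↦ ?_) hξ'.ge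
      (Or.inl (by simp [hc]))
    rw [← Module.forall_dual_apply_eq_zero_iff k]
    intro η
    have htop : stabilizer k η = ⊤ := Submodule.eq_top_of_finrank_eq
      (le_antisymm (Submodule.finrank_le _) (by have := index_le η; omega))
    have hx : x ∈ stabilizer k η := htop ▸ Submodule.mem_top
    exact hx y
  · obtain ⟨x, y, hxy⟩ : ∃ x y : L, ξ ⁅x, y⁆ ≠ 0 := by
      by_contra! h
      have htop : stabilizer k ξ = ⊤ := top_le_iff.mp fun x _ y ↦ h x y
      rw [htop, finrank_top] at hm
      omega
    have hxy' : ξ ⁅(ξ ⁅x, y⁆)⁻¹ • x, y⁆ = 1 := by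
      rw [smul_lie, map_smul, smul_eq_mul, inv_mul_cancel₀ hxy]
    exact hasRProperty_of_commuting (stabilizer k ξ)
      (fun s hs t ht ↦ lie_eq_zero_of_mem_stabilizer (by omega) hxy' hs ht) hξ'.ge
      (Or.inr (by simp [hc]))

end Classification

end RentschlerProperty

/-! ### Assembly by dimension and index -/

theorem theorem5p2 {k : Type*} [Field k] [IsAlgClosed k] [CharZero k]
    {L : Type*} [LieRing L] [LieAlgebra k L] [FiniteDimensional k L]
    [LieAlgebra.IsSolvable L] :
    (Module.finrank k L ≤ 6 → RentschlerProperty.HasRProperty k L) ∧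
    (Module.finrank k L = 7 →
      (RentschlerProperty.index k L ≠ 3 ∨
        (RentschlerProperty.index k L = 3 ∧ ¬ RentschlerProperty.IsQuasiQuadratic k L)) →
      RentschlerProperty.HasRProperty k L) := by
  obtain ⟨m, hn, hc, hm⟩ := RentschlerProperty.exists_eq_index_add (k := k) (L := L)
  obtain ⟨A, hA, hC⟩ := RentschlerProperty.exists_selfCentralizing_ideal k L
  obtain ⟨b₁, b₂, b₃⟩ := RentschlerProperty.finrank_bounds hC
  have concl : ∀ H : Submodule k L, (∀ x ∈ H, ∀ y ∈ H, ⁅x, y⁆ = 0) →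
      RentschlerProperty.index k L + m ≤ Module.finrank k H + 1 →
      RentschlerProperty.HasRProperty k L := by
    intro H hH hd
    rcases Nat.lt_or_ge 1 m with h1 | h1
    · refine RentschlerProperty.hasRProperty_of_commuting H hH
        -- This is c(L) - 1; the truncated subtraction is harmless because m > 1.
        (d := RentschlerProperty.index k L + m - 1) (by omega) (Or.inr ?_)
      rw [hc, Nat.cast_sub (by omega)]
      simp
    · exact hm h1
  have conclA := concl A.toSubmodule hA
  change _ ≤ Module.finrank k A + 1 → _ at conclA
  refine ⟨fun h6 ↦ ?_, fun h7 hi ↦ ?_⟩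
  · rcases Nat.lt_or_ge 1 m with h1 | h1
    -- The required dimension is n - m - 1 with m ≥ 2: at most 1, 2, 3 for n = 4, 5, 6, within the
    -- bounds on dim A.
    · exact conclA (by omega)
    · exact hm h1
  · rcases Nat.lt_or_ge 1 m with h1 | h1
    swap
    · exact hm h1
    rcases hi with hi | ⟨hi, hq⟩
    -- Here i(L) = 1 and m = 3, so dimension 3 suffices.
    · exact conclA (by omega)
    · by_cases h3 : Module.finrank k A = 3
      · obtain ⟨F⟩ := RentschlerProperty.nonempty_abelianFlag hA hC h3
        obtain ⟨H, hH, hd⟩ := F.exists_commuting h7 hi hq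
        exact concl H hH (by omega)
      · exact conclA (by omega)
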